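/- Let $k$ be a field, let $n, r \ge 0$ be integers, and assume that the characteristic of $k$ is strictly larger than $r$ (characteristic zero is regarded as infinite, hence larger than every $r$). Let $T^{n,r} = (k^n)^{\otimes r}$, with the diagonal left action $g\cdot(v_1\otimes\cdots\otimes v_r) = gv_1\otimes\cdots\otimes gv_r$ of $\mathrm{GL}_n(k)$ and the right action $(v_1\otimes\cdots\otimes v_r)\cdot\sigma = v_{\sigma(1)}\otimes\cdots\otimes v_{\sigma(r)}$ of the symmetric group $\Sigma_r$. Let $L(k^n)$ be the free Lie algebra on $k^n$, that is, the Lie subalgebra generated by $k^n$ in the tensor algebra of $k^n$ with bracket $[a,b]=ab-ba$, and let $L^{n,r} = L(k^n)\cap T^{n,r}$ be the space of homogeneous Lie polynomials of degree $r$. Let $e \in k\Sigma_r$ be a Lie idempotent, that is, an element with $e^2=e$ and $L^{n,r} = T^{n,r}\cdot e$. The actions above restrict to commuting actions of $k\mathrm{GL}_n(k)$ on the left and of $e\,k\Sigma_r\,e$ on the right of $L^{n,r}$; let $\Phi_e(k\mathrm{GL}_n(k))$ and $\Psi_e(e\,k\Sigma_r\,e)$ denote the sets of $k$-linear endomorphisms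 of $L^{n,r}$ that they induce. Then the triple $(k\mathrm{GL}_n(k), L^{n,r}, e\,k\Sigma_r\,e)$ satisfies Schur--Weyl duality, that is, both inclusions $\Phi_e(k\mathrm{GL}_n(k)) \subseteq \mathrm{End}_{e k\Sigma_r e}(L^{n,r})$ and $\Psi_e(e\,k\Sigma_r\,e)\subseteq \mathrm{End}_{\mathrm{GL}_n(k)}(L^{n,r})$ are equalities: $$\Phi_e(k\mathrm{GL}_n(k)) = \mathrm{End}_{e k\Sigma_r e}(L^{n,r}) \quad\text{and}\quad \Psi_e(e\,k\Sigma_r\,e)= \mathrm{End}_{\mathrm{GL}_n(k)}(L^{n,r}).$$ -/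

import Mathlib

open scoped TensorProduct

noncomputable section

namespace LieSchurWeyl

universe u v w x

/-! ### Schur-Weyl duality for a triple `(A, V, B)` -/

/-- Let `V` be a `k`-module with a left action `Φ` of a `k`-algebra `A` and a right action of a
`k`-algebra `B`, the latter given as an algebra homomorphism `Ψ` out of `Bᵐᵒᵖ`.  The triple
`(A, V, B)` satisfies Schur-Weyl duality when, in `End_k V`, the image of `A` is the whole
centralizer `End_B V` of the image of `B`, and the image of `B` is the whole centralizer
`End_A V` of the image of `A`. -/
def SatisfiesSchurWeylDuality {k : Type u} [CommRing k]
    {A : Type v} [Ring A] [Algebra k A] {B : Type w} [Ring B] [Algebra k B]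
    {V : Type x} [AddCommGroup V] [Module k V]
    (Φ : A →ₐ[k] Module.End k V) (Ψ : Bᵐᵒᵖ →ₐ[k] Module.End k V) : Prop :=
  Φ.range = Subalgebra.centralizer k (Ψ.range : Set (Module.End k V)) ∧
    Ψ.range = Subalgebra.centralizer k (Φ.range : Set (Module.End k V))

/-! ### The `k`-algebra `e B e` -/

section Corner

variable {k : Type u} [CommRing k] {B : Type v} [Ring B] [Algebra k B] {e : B}

theorem corner_mul_left (he : IsIdempotentElem e) (b : he.Corner) : e * b.1 = b.1 :=
  ((Subsemigroup.mem_corner_iff he).mp b.2).1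

theorem corner_mul_right (he : IsIdempotentElem e) (b : he.Corner) : b.1 * e = b.1 :=
  ((Subsemigroup.mem_corner_iff he).mp b.2).2

/-- Scalars act on `e B e` as they do on `B`; the structure map is `c ↦ c • e`. -/
instance cornerAlgebra (he : IsIdempotentElem e) : Algebra k he.Corner where
  smul c b := ⟨c • b.1, (Subsemigroup.mem_corner_iff he).mpr
    ⟨by rw [mul_smul_comm, corner_mul_left], by rw [smul_mul_assoc, corner_mul_right]⟩⟩
  algebraMap :=
    { toFun := fun c => ⟨c • e, (Subsemigroup.mem_corner_iff he).mpr
        ⟨by rw [mul_smul_comm, he.eq], by rw [smul_mul_assoc, he.eq]⟩⟩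
      map_one' := Subtype.ext (one_smul k e)
      map_mul' := fun c d => Subtype.ext (show (c * d) • e = (c • e) * (d • e) by
        rw [smul_mul_smul_comm, he.eq])
      map_zero' := Subtype.ext (zero_smul k e)
      map_add' := fun c d => Subtype.ext (add_smul c d e) }
  commutes' c b := Subtype.ext (show (c • e) * b.1 = b.1 * (c • e) by
    rw [smul_mul_assoc, mul_smul_comm, corner_mul_left, corner_mul_right])
  smul_def' c b := Subtype.ext (show c • b.1 = (c • e) * b.1 by
    rw [smul_mul_assoc, corner_mul_left])

end Corner

variable (k : Type u) [Field k] (n r : ℕ)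

/-! ### Tensor space and the classical commuting actions -/

/-- The tensor space `T^{n,r} = (k^n)^{⊗ r}`. -/
abbrev TensorSpace : Type u := ⨂[k]^r (Fin n → k)

/-- The diagonal action of `GL_n(k)`:
`g · (v₁ ⊗ ⋯ ⊗ vᵣ) = g v₁ ⊗ ⋯ ⊗ g vᵣ`. -/
def glAct : GL (Fin n) k →* Module.End k (TensorSpace k n r) where
  toFun g := PiTensorProduct.map fun _ : Fin r => Matrix.mulVecLin (g : Matrix (Fin n) (Fin n) k)
  map_one' := by
    simp only [Units.val_one, Matrix.mulVecLin_one]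
    exact PiTensorProduct.map_id
  map_mul' g h := by
    simp only [Units.val_mul, Matrix.mulVecLin_mul]
    exact PiTensorProduct.map_comp _ _

/-- The right action of `Σ_r` by place permutation:
`(v₁ ⊗ ⋯ ⊗ vᵣ) · σ = v_{σ(1)} ⊗ ⋯ ⊗ v_{σ(r)}`.  Being a right action, it is a homomorphism to
the opposite of the endomorphism algebra. -/
def permAct : Equiv.Perm (Fin r) →* (Module.End k (TensorSpace k n r))ᵐᵒᵖ where
  toFun σ := MulOpposite.op
    (PiTensorProduct.reindex k (fun _ : Fin r => Fin n → k) σ.symm).toLinearMap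
  map_one' := by
    congr 1
    refine PiTensorProduct.ext (MultilinearMap.ext fun v => ?_)
    exact PiTensorProduct.reindex_tprod _ _
  map_mul' σ τ := by
    rw [← MulOpposite.op_mul]
    congr 1
    refine PiTensorProduct.ext (MultilinearMap.ext fun v => ?_)
    refine (PiTensorProduct.reindex_tprod (R := k) (s := fun _ => Fin n → k) (σ * τ).symm v).trans (Eq.symm ?_)
    refine (congrArg
      (PiTensorProduct.reindex k (fun _ : Fin r => Fin n → k) τ.symm) (PiTensorProduct.reindex_tprod (R := k) (s := fun _ => Fin n → k) σ.symm v)).trans ?_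
    exact PiTensorProduct.reindex_tprod (R := k) (s := fun _ => Fin n → k) τ.symm fun i => v (σ i)

/-- The homomorphism `Φ : k GL_n(k) → End_k(T^{n,r})`. -/
def Phi : MonoidAlgebra k (GL (Fin n) k) →ₐ[k] Module.End k (TensorSpace k n r) :=
  MonoidAlgebra.lift k _ _ (glAct k n r)

/-- The right action of the group algebra `k Σ_r` on tensor space, as a homomorphism
`Ψ : (k Σ_r)ᵐᵒᵖ → End_k(T^{n,r})`. -/
def Psi : (MonoidAlgebra k (Equiv.Perm (Fin r)))ᵐᵒᵖ →ₐ[k] Module.End k (TensorSpace k n r) :=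
  AlgHom.opComm (MonoidAlgebra.lift k _ _ (permAct k n r))

theorem glAct_tprod (g : GL (Fin n) k) (v : Fin r → Fin n → k) :
    glAct k n r g (PiTensorProduct.tprod k v) =
      PiTensorProduct.tprod k fun i => (g : Matrix (Fin n) (Fin n) k).mulVec (v i) := by
  simp [glAct]

theorem Psi_single_tprod (σ : Equiv.Perm (Fin r)) (v : Fin r → Fin n → k) :
    Psi k n r (MulOpposite.op (MonoidAlgebra.single σ 1)) (PiTensorProduct.tprod k v) =
      PiTensorProduct.tprod k fun i => v (σ i) := by
  simp [Psi, permAct, PiTensorProduct.reindex_tprod]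

/-! ### Homogeneous Lie polynomials -/

attribute [local instance] LieRing.ofAssociativeRing

/-- The free Lie algebra `L(k^n)`: the Lie subalgebra of the tensor algebra of `k^n`, with bracket
`[a, b] = a b - b a`, generated by `k^n`. -/
def freeLie : LieSubalgebra k (TensorAlgebra k (Fin n → k)) :=
  LieSubalgebra.lieSpan k _ (Set.range (TensorAlgebra.ι k))

/-- The space `L^{n,r}` of homogeneous Lie polynomials of degree `r`, that is, the intersection of
`L(k^n)` with the degree `r` part `T^{n,r}` of the tensor algebra. -/
def LieSpace : Submodule k (TensorSpace k n r) :=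
  (freeLie k n).toSubmodule.comap TensorPower.toTensorAlgebra

/-- A Lie idempotent: an idempotent `e` of `k Σ_r` with `L^{n,r} = T^{n,r} · e`. -/
structure IsLieIdempotent (e : MonoidAlgebra k (Equiv.Perm (Fin r))) : Prop where
  idem : IsIdempotentElem e
  range_eq : LieSpace k n r = LinearMap.range (Psi k n r (MulOpposite.op e))

/-! ### The actions on `L^{n,r}` -/

theorem toTensorAlgebra_glAct (g : GL (Fin n) k) (t : TensorSpace k n r) :
    TensorPower.toTensorAlgebra (glAct k n r g t) =
      TensorAlgebra.lift k ((TensorAlgebra.ι k).comp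
        (Matrix.mulVecLin (g : Matrix (Fin n) (Fin n) k))) (TensorPower.toTensorAlgebra t) := by
  induction t using PiTensorProduct.induction_on with
  | smul_tprod c v =>
    simp only [map_smul, glAct_tprod, TensorPower.toTensorAlgebra_tprod, TensorAlgebra.tprod_apply,
      map_list_prod, List.map_ofFn]
    congr 3
    ext i
    simp
  | add x y hx hy => simp only [map_add, hx, hy]

theorem glAct_mem (g : GL (Fin n) k) {t : TensorSpace k n r} (ht : t ∈ LieSpace k n r) :
    glAct k n r g t ∈ LieSpace k n r := by
  set F := TensorAlgebra.lift k ((TensorAlgebra.ι k).comp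
        (Matrix.mulVecLin (g : Matrix (Fin n) (Fin n) k))) with hF
  have key : freeLie k n ≤ (freeLie k n).comap (F : _ →ₗ⁅k⁆ _) := by
    refine LieSubalgebra.lieSpan_le.mpr ?_
    rintro _ ⟨v, rfl⟩
    refine LieSubalgebra.subset_lieSpan ⟨Matrix.mulVecLin (g : Matrix (Fin n) (Fin n) k) v, ?_⟩
    simp [hF]
  have h := key ht
  change TensorPower.toTensorAlgebra (glAct k n r g t) ∈ freeLie k n
  rw [toTensorAlgebra_glAct]
  exact h

theorem Phi_mem (a : MonoidAlgebra k (GL (Fin n) k)) {t : TensorSpace k n r}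
    (ht : t ∈ LieSpace k n r) : Phi k n r a t ∈ LieSpace k n r := by
  rw [Phi, MonoidAlgebra.lift_apply, Finsupp.sum, LinearMap.sum_apply]
  exact Submodule.sum_mem _ fun g _ => Submodule.smul_mem _ _ (glAct_mem k n r g ht)

/-- The homomorphism `Φ_e : k GL_n(k) → End_k(L^{n,r})`, the restriction of `Φ`. -/
def PhiLie : MonoidAlgebra k (GL (Fin n) k) →ₐ[k] Module.End k (LieSpace k n r) where
  toFun a := (Phi k n r a).restrict fun _ => Phi_mem k n r a
  map_one' := by ext; simp
  map_mul' a b := by ext; simp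
  map_zero' := by ext; simp
  map_add' a b := by ext; simp
  commutes' c := by
    ext t
    change Phi k n r (algebraMap k _ c) t = c • (t : TensorSpace k n r)
    rw [AlgHom.commutes]
    rfl

variable {k n r}

theorem IsLieIdempotent.Psi_eq_self {e : MonoidAlgebra k (Equiv.Perm (Fin r))}
    (he : IsLieIdempotent k n r e) {t : TensorSpace k n r} (ht : t ∈ LieSpace k n r) :
    Psi k n r (MulOpposite.op e) t = t := by
  rw [he.range_eq] at ht
  obtain ⟨s, rfl⟩ := ht
  rw [← Module.End.mul_apply, ← map_mul, ← MulOpposite.op_mul, he.idem.eq]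

theorem IsLieIdempotent.Psi_mem {e : MonoidAlgebra k (Equiv.Perm (Fin r))}
    (he : IsLieIdempotent k n r e) (b : he.idem.Corner) (t : TensorSpace k n r) :
    Psi k n r (MulOpposite.op b.1) t ∈ LieSpace k n r := by
  rw [he.range_eq, ← corner_mul_right he.idem b, MulOpposite.op_mul, map_mul]
  exact ⟨_, rfl⟩

/-- The right action of `e k Σ_r e` on `L^{n,r}`, the restriction of the right action of `k Σ_r`
on tensor space, as a homomorphism `Ψ_e : (e k Σ_r e)ᵐᵒᵖ → End_k(L^{n,r})`. -/
def PsiLie {e : MonoidAlgebra k (Equiv.Perm (Fin r))} (he : IsLieIdempotent k n r e) :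
    (he.idem.Corner)ᵐᵒᵖ →ₐ[k] Module.End k (LieSpace k n r) where
  toFun b := (Psi k n r (MulOpposite.op b.unop.1)).restrict fun t _ => he.Psi_mem b.unop t
  map_one' := by
    ext t
    exact he.Psi_eq_self t.2
  map_mul' a b := by
    ext t
    change Psi k n r (MulOpposite.op (b.unop.1 * a.unop.1)) t = _
    rw [MulOpposite.op_mul, map_mul]
    rfl
  map_zero' := by
    ext t
    change Psi k n r (MulOpposite.op 0) t = 0
    simp
  map_add' a b := by
    ext t
    change Psi k n r (MulOpposite.op (a.unop.1 + b.unop.1)) t = _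
    rw [MulOpposite.op_add, map_add]
    rfl
  commutes' c := by
    ext t
    change Psi k n r (MulOpposite.op (c • e)) t = c • (t : TensorSpace k n r)
    rw [MulOpposite.op_smul, map_smul, LinearMap.smul_apply, he.Psi_eq_self t.2]

end LieSchurWeyl

end

/-!
Two double centralizer arguments give the result: one for the classical triple
`(k GL_n(k), T^{n,r}, k Σ_r)`, and one that cuts it down by the idempotent `e`.

Since the characteristic exceeds `r`, the algebra `k Σ_r` is semisimple. The image of `k GL_n(k)`
in `End_k(T^{n,r})` is the centralizer of `Σ_r` (`range_Phi_eq_centralizer`): averaging over `Σ_r`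
shows that this centralizer is spanned by the symmetrizations of `A₁ ⊗ ⋯ ⊗ Aᵣ`, and polarization
(`sum_perm_mem_of_forall_diag_mem`) expresses these through powers `A ⊗ ⋯ ⊗ A`. A singular `A` has
to be replaced by invertible matrices, and `k` may be a finite field with fewer elements than
`det (A + t)` has potential roots. However, `A` is a product of invertible matrices and nilpotent
ones, and if `A` is nilpotent, then `A + t` is invertible for every `t ≠ 0`. The power
`(A + t) ⊗ ⋯ ⊗ (A + t)` is polynomial in `t` of degree `r` with leading term `1 ⊗ ⋯ ⊗ 1`, so this
term and the values at `t = 1, …, r` determine its constant term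
(`diag_mem_of_forall_add_smul_mem`). The other equality, that `k Σ_r` surjects onto the centralizer
of `GL_n(k)`, is then the double centralizer theorem for semisimple algebras
(`mem_range_of_mem_centralizer_centralizer`).

For the passage to `L^{n,r} = T^{n,r} e`, an endomorphism commuting with `e k Σ_r e` extends to an
endomorphism of `T^{n,r}` commuting with `k Σ_r`, again by semisimplicity
(`exists_mem_centralizer_mul_eq`), and thus comes from `k GL_n(k)`. An endomorphism `f` commuting
with `GL_n(k)` is extended by precomposition with the projection `e`; the extension is the action of
some `b` in `k Σ_r`, and `f` is the action of `e b e`.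
-/

namespace LieSchurWeyl

/-! ### Modules over semisimple algebras -/

section Semisimple

variable {k R M : Type*} [Field k] [Ring R] [Algebra k R] [IsSemisimpleRing R]
  [AddCommGroup M] [Module k M]

/-- Let `R` be semisimple and `e` an idempotent of `R`. Every endomorphism of `e M` that commutes
with `e R e` extends to an endomorphism of `M` that commutes with `R`. The given endomorphism of
`e M` is encoded as the map `f` on `M` obtained by precomposing it with the action of `e`. -/
theorem exists_mem_centralizer_mul_eq (ρ : R →ₐ[k] Module.End k M) {e : R} (he : IsIdempotentElem e)
    (f : Module.End k M) (hfe : f * ρ e = f)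
    (hf : ∀ r : R, f * ρ (e * r * e) = ρ (e * r * e) * f) :
    ∃ F ∈ Subalgebra.centralizer k (ρ.range : Set (Module.End k M)), F * ρ e = f := by
  let _ : Module R M := Module.compHom M ρ.toRingHom
  have smul_eq (x : R) (m : M) : x • m = ρ x m := rfl
  have hfe' (m : M) : f (e • m) = f m := LinearMap.congr_fun hfe m
  have hef (m : M) : e • f m = f m := by
    have h := LinearMap.congr_fun (hf 1) m
    rw [mul_one, he.eq, hfe] at h
    exact h.symm
  have hf' (r : R) (m : M) : e • r • f m = f (r • e • m) := by
    have hcomm := LinearMap.congr_fun (hf r) m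
    simp only [map_mul, Module.End.mul_apply] at hcomm
    simpa only [← smul_eq, hfe', hef] using hcomm.symm
  -- The submodule spanned by the graph of `e • m ↦ f m`. It is again a graph, because the fibre
  -- over `0` is a submodule killed by `e`, whereas the generators are fixed by `e`.
  let N : Submodule R (M × M) := Submodule.span R (Set.range fun m => (e • m, f m))
  have hN (x : M × M) (hx : x ∈ N) : ∀ r : R, e • r • x.2 = f (r • x.1) := by
    induction hx using Submodule.span_induction with
    | mem x hx => obtain ⟨m, rfl⟩ := hx; exact fun r => hf' r m
    | zero => simp
    | add x y _ _ hx hy => intro r; simp [hx r, hy r]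
    | smul a x _ hx => intro r; simpa [mul_smul] using hx (r * a)
  let p₁ : N →ₗ[R] M := LinearMap.fst R M M ∘ₗ N.subtype
  let p₂ : N →ₗ[R] M := LinearMap.snd R M M ∘ₗ N.subtype
  have hp₁ : Function.Injective p₁ := by
    obtain ⟨C, hC⟩ := exists_isCompl (LinearMap.ker p₁)
    have hgen (m : M) (hm : (e • m, f m) ∈ N) : (⟨_, hm⟩ : N) ∈ C := by
      obtain ⟨x, hx, c, hc, hxc⟩ := Submodule.mem_sup.mp
        (hC.sup_eq_top.ge (Submodule.mem_top (x := (⟨_, hm⟩ : N))))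
      have hx1 : x.1.1 = 0 := hx
      have hex : e • x = 0 := by
        refine Subtype.ext (Prod.ext ?_ ?_)
        · simp [hx1]
        · simpa [hx1] using hN x.1 x.2 1
      have hg : e • (⟨_, hm⟩ : N) = ⟨_, hm⟩ :=
        Subtype.ext (Prod.ext (by simp [smul_smul, he.eq]) (hef m))
      rw [← hg, ← hxc, smul_add, hex, zero_add]
      exact C.smul_mem _ hc
    have hCtop : C = ⊤ := by
      have : N ≤ C.map N.subtype := by
        refine Submodule.span_le.mpr ?_
        rintro _ ⟨m, rfl⟩
        exact ⟨_, hgen m (Submodule.subset_span ⟨m, rfl⟩), rfl⟩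
      refine eq_top_iff.mpr fun x _ => ?_
      obtain ⟨y, hy, hyx⟩ := this x.2
      rwa [← Subtype.ext hyx]
    rw [← LinearMap.ker_eq_bot]
    simpa [hCtop] using hC.inf_eq_bot
  obtain ⟨F, hF⟩ := IsSemisimpleModule.extension_property p₁ hp₁ p₂
  let F' : Module.End k M :=
    { toFun := F, map_add' := map_add F
      map_smul' := fun c m => by
        have := map_smul F (algebraMap k R c) m
        simpa [smul_eq] using this }
  refine ⟨F', ?_, LinearMap.ext fun m => ?_⟩
  · rw [Subalgebra.mem_centralizer_iff]
    rintro _ ⟨x, rfl⟩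
    exact LinearMap.ext fun m => (map_smul F x m).symm
  · exact LinearMap.congr_fun hF ⟨(e • m, f m), Submodule.subset_span ⟨m, rfl⟩⟩

/-- The double centralizer theorem for a finite-dimensional representation of a semisimple algebra;
it follows from the Jacobson density theorem, because `R`-linear maps are `k`-linear. -/
theorem mem_range_of_mem_centralizer_centralizer [Module.Finite k M] (ρ : R →ₐ[k] Module.End k M)
    {T : Module.End k M} (hT : T ∈ Subalgebra.centralizer k
      (Subalgebra.centralizer k (ρ.range : Set (Module.End k M)) : Set (Module.End k M))) :
    T ∈ ρ.range := by
  let _ : Module R M := Module.compHom M ρ.toRingHom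
  have smul_eq (x : R) (m : M) : x • m = ρ x m := rfl
  have : SMulCommClass R k M := ⟨fun x c m => map_smul (ρ x) c m⟩
  have : SMulCommClass k R M := SMulCommClass.symm _ _ _
  have : IsScalarTower k (Module.End R M) M := ⟨fun _ _ _ => rfl⟩
  have : Module.Finite (Module.End R M) M := Module.Finite.of_restrictScalars_finite k _ _
  have hcomm (g : Module.End R M) (m : M) : T (g m) = g (T m) := by
    let g' : Module.End k M :=
      { toFun := g, map_add' := map_add g
        map_smul' := fun c m => by
          have := map_smul g (algebraMap k R c) m
          simpa [smul_eq] using this }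
    have hg : g' ∈ Subalgebra.centralizer k (ρ.range : Set (Module.End k M)) := by
      rw [Subalgebra.mem_centralizer_iff]
      rintro _ ⟨x, rfl⟩
      exact LinearMap.ext fun m => (map_smul g x m).symm
    have := (Subalgebra.mem_centralizer_iff k).mp hT g' hg
    exact (LinearMap.congr_fun this m).symm
  let T' : Module.End (Module.End R M) M :=
    { toFun := T, map_add' := map_add T, map_smul' := hcomm }
  obtain ⟨x, hx⟩ := Module.Finite.toModuleEnd_moduleEnd_surjective (R := R) (M := M) T'
  exact ⟨x, LinearMap.ext fun m => LinearMap.congr_fun hx m⟩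

end Semisimple

/-! ### Diagonal values of multilinear maps -/

section Multilinear

variable {k ι E M : Type*} [Field k] [Fintype ι] [AddCommGroup E] [Module k E]
  [AddCommGroup M] [Module k M]

/-- The polynomial `t ↦ f (a + t b, …, a + t b)` has degree at most `card ι`. If its leading
coefficient and its values at `t ≠ 0` lie in `W`, so does its constant term. The hypothesis on the
leading coefficient allows interpolation at only `card ι` points, so that it applies even when `k`
has exactly `card ι` nonzero elements. -/
theorem diag_mem_of_forall_add_smul_mem
    (hk : Set.InjOn (Nat.cast : ℕ → k) (Set.Iic (Fintype.card ι)))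
    (f : MultilinearMap k (fun _ : ι => E) M) (W : Submodule k M) {a b : E}
    (hb : f (fun _ => b) ∈ W) (h : ∀ t : k, t ≠ 0 → f (fun _ => a + t • b) ∈ W) :
    f (fun _ => a) ∈ W := by
  classical
  by_contra ha
  obtain ⟨φ, hφa, hφ⟩ := W.exists_dual_map_eq_bot_of_notMem ha inferInstance
  have hφW (x : M) (hx : x ∈ W) : φ x = 0 := by
    have : φ x ∈ W.map φ := Submodule.mem_map_of_mem hx
    rwa [hφ, Submodule.mem_bot] at this
  -- The coefficients of the polynomial, separated from `W` by the functional `φ`.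
  let c (s : Finset ι) : k := φ (f (s.piecewise (fun _ => a) fun _ => b))
  let p : Polynomial k := ∑ s : Finset ι, Polynomial.monomial sᶜ.card (c s)
  have hc : c ∅ = 0 := by
    simpa [c] using hφW _ hb
  have hdeg : p.degree < (Finset.range (Fintype.card ι)).card := by
    rw [Finset.card_range, ← Polynomial.mem_degreeLT]
    refine Submodule.sum_mem _ fun s _ => ?_
    rcases s.eq_empty_or_nonempty with rfl | hs
    · simp [hc]
    · rw [Polynomial.mem_degreeLT]
      refine (Polynomial.degree_monomial_le _ _).trans_lt ?_
      exact_mod_cast (Finset.card_compl_lt_iff_nonempty s).mpr hs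
  have heval (t : k) : p.eval t = φ (f fun _ => a + t • b) := by
    have : (fun _ : ι => a + t • b) = (fun _ => a) + fun _ => t • b := rfl
    rw [this, f.map_add_univ, map_sum, Polynomial.eval_finsetSum]
    refine Finset.sum_congr rfl fun s _ => ?_
    have : s.piecewise (fun _ : ι => a) (fun _ => t • b) =
        sᶜ.piecewise (fun i => (fun _ => t) i • s.piecewise (fun _ => a) (fun _ => b) i)
          (s.piecewise (fun _ => a) fun _ => b) := by
      ext i
      by_cases hi : i ∈ s <;> simp [hi]
    rw [this, f.map_piecewise_smul, map_smul]
    simp [c, mul_comm]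
  have hp : p = 0 := by
    refine Polynomial.eq_zero_of_degree_lt_of_eval_index_eq_zero
      (Finset.range (Fintype.card ι)) (v := fun i : ℕ => ((i + 1 : ℕ) : k)) ?_ hdeg ?_
    · intro i hi j hj hij
      simp only [Finset.coe_range, Set.mem_Iio] at hi hj
      exact Nat.succ_injective (hk (Set.mem_Iic.mpr hi) (Set.mem_Iic.mpr hj) hij)
    · intro i hi
      rw [heval]
      refine hφW _ (h _ fun h0 => ?_)
      have := hk (Set.mem_Iic.mpr (Finset.mem_range.mp hi)) (Set.mem_Iic.mpr (Nat.zero_le _))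
        (h0.trans Nat.cast_zero.symm)
      omega
  refine hφa ?_
  have := heval 0
  simpa [hp] using this.symm

/-- Polarization: the symmetrization of a multilinear map is a combination of its values on the
diagonal. -/
theorem sum_perm_mem_of_forall_diag_mem [DecidableEq ι] (f : MultilinearMap k (fun _ : ι => E) M)
    (W : Submodule k M) (h : ∀ a, f (fun _ => a) ∈ W) (A : ι → E) :
    ∑ σ : Equiv.Perm ι, f (fun i => A (σ i)) ∈ W := by
  -- Inclusion-exclusion isolates, in the expansion over all maps `g : ι → ι`, the surjective ones.
  have key : ∑ s : Finset ι, (-1 : ℤ) ^ s.card • f (fun _ => ∑ i ∈ sᶜ, A i) =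
      ∑ σ : Equiv.Perm ι, f (fun i => A (σ i)) := by
    have h1 (s : Finset ι) : (-1 : ℤ) ^ s.card • f (fun _ => ∑ i ∈ sᶜ, A i) =
        ∑ g : ι → ι, if s ⊆ (Finset.univ.image g)ᶜ then
          (-1 : ℤ) ^ s.card • f (fun i => A (g i)) else 0 := by
      rw [f.map_sum_finset (fun _ => A) (fun _ => sᶜ), Finset.smul_sum, ← Finset.sum_filter]
      refine Finset.sum_congr ?_ fun _ _ => rfl
      ext g
      simp only [Fintype.mem_piFinset, Finset.mem_compl, Finset.mem_filter, Finset.mem_univ,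
        true_and, Finset.subset_iff, Finset.mem_image, not_exists]
      exact ⟨fun H x hx i hi => H i (hi ▸ hx), fun H i hi => H hi i rfl⟩
    simp_rw [h1]
    rw [Finset.sum_comm]
    have h2 (g : ι → ι) : (∑ s : Finset ι, if s ⊆ (Finset.univ.image g)ᶜ then
          (-1 : ℤ) ^ s.card • f (fun i => A (g i)) else 0) =
        if Function.Bijective g then f (fun i => A (g i)) else 0 := by
      rw [← Finset.sum_filter, ← Finset.sum_smul]
      have : (Finset.univ.filter fun s : Finset ι => s ⊆ (Finset.univ.image g)ᶜ) =
          ((Finset.univ.image g)ᶜ).powerset := by ext; simp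
      have hg : (Finset.univ.image g)ᶜ = ∅ ↔ Function.Bijective g := by
        rw [← Finite.surjective_iff_bijective, Finset.compl_eq_empty_iff, Finset.eq_univ_iff_forall]
        simp [Function.Surjective]
      rw [this, Finset.sum_powerset_neg_one_pow_card]
      simp only [hg]
      split_ifs <;> simp
    simp_rw [h2]
    rw [← Finset.sum_filter]
    symm
    refine Finset.sum_bij (fun σ _ => σ) (fun σ _ => by simp)
      (fun _ _ _ _ h => DFunLike.coe_injective h) (fun g hg => ?_) fun _ _ => rfl
    exact ⟨Equiv.ofBijective g (by simpa using hg), Finset.mem_univ _, rfl⟩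
  rw [← key]
  exact Submodule.sum_mem _ fun s _ => zsmul_mem (h _) _

end Multilinear

/-! ### Nilpotent multiples of singular diagonal matrices -/

section Nilpotent

variable {k : Type*} [Field k] {m : ℕ}

open scoped Fin.NatCast Fin.CommRing in
/-- A diagonal matrix with a zero entry times a cyclic permutation matrix is nilpotent: running
once around the cycle, the product of the entries picks up the zero. -/
theorem isNilpotent_diagonal_mul_permMatrix (d : Fin (m + 1) → k) {i₀ : Fin (m + 1)}
    (h : d i₀ = 0) :
    IsNilpotent (Matrix.diagonal d * (Equiv.addRight (1 : Fin (m + 1))).permMatrix k) := by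
  set N := Matrix.diagonal d * (Equiv.addRight (1 : Fin (m + 1))).permMatrix k with hN
  -- `(N v)(i) = d(i) v(i + 1)`, iterated.
  have hpow (j : ℕ) (v : Fin (m + 1) → k) (i : Fin (m + 1)) :
      (N ^ j).mulVec v i = (∏ l ∈ Finset.range j, d (i + (l : Fin (m + 1)))) *
        v (i + (j : Fin (m + 1))) := by
    induction j generalizing v with
    | zero => simp
    | succ j ih =>
      rw [pow_succ, ← Matrix.mulVec_mulVec, ih, hN, ← Matrix.mulVec_mulVec,
        Matrix.mulVec_diagonal, Matrix.permMatrix_mulVec, Finset.prod_range_succ]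
      simp [add_assoc, mul_assoc]
  refine ⟨m + 1, Matrix.ext_of_mulVec_single fun i => funext fun j => ?_⟩
  rw [hpow, Matrix.zero_mulVec, Finset.prod_eq_zero (i := (i₀ - j).val), zero_mul]
  · rfl
  · exact Finset.mem_range.mpr (i₀ - j).isLt
  · simp [h]

end Nilpotent

/-! ### The classical duality -/

section Classical

variable {k : Type*} [Field k] {n r : ℕ}

theorem natCast_injOn_Iic (h : ringChar k = 0 ∨ r < ringChar k) :
    Set.InjOn (Nat.cast : ℕ → k) (Set.Iic r) := by
  rcases h with h | h
  · have : CharZero k := (CharP.ringChar_zero_iff_CharZero k).mp h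
    exact Nat.cast_injective.injOn
  · exact (CharP.natCast_injOn_Iio k (ringChar k)).mono fun i hi => lt_of_le_of_lt hi h

theorem factorial_cast_ne_zero (h : ringChar k = 0 ∨ r < ringChar k) :
    (r.factorial : k) ≠ 0 := by
  rw [← Finset.prod_range_add_one_eq_factorial, Nat.cast_prod, Finset.prod_ne_zero_iff]
  intro i hi h0
  have := natCast_injOn_Iic h (Set.mem_Iic.mpr (Finset.mem_range.mp hi))
    (Set.mem_Iic.mpr (Nat.zero_le _)) (h0.trans Nat.cast_zero.symm)
  omega

variable (k n r) in
/-- The multilinear map `(A₁, …, Aᵣ) ↦ A₁ ⊗ ⋯ ⊗ Aᵣ` from matrices to endomorphisms of tensor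
space. -/
noncomputable def tensorMul : MultilinearMap k (fun _ : Fin r => Matrix (Fin n) (Fin n) k)
    (Module.End k (TensorSpace k n r)) :=
  (PiTensorProduct.mapMultilinear k _ _).compLinearMap fun _ => (Matrix.toLin' (R := k)).toLinearMap

theorem tensorMul_tprod (A : Fin r → Matrix (Fin n) (Fin n) k) (v : Fin r → Fin n → k) :
    tensorMul k n r A (PiTensorProduct.tprod k v) =
      PiTensorProduct.tprod k fun i => (A i).mulVec (v i) := by
  simp [tensorMul]

theorem tensorMul_mul (A B : Fin r → Matrix (Fin n) (Fin n) k) :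
    tensorMul k n r (fun i => A i * B i) = tensorMul k n r A * tensorMul k n r B := by
  refine PiTensorProduct.ext (MultilinearMap.ext fun v => ?_)
  simp [tensorMul_tprod]

theorem tensorMul_diag_mem_of_isUnit {A : Matrix (Fin n) (Fin n) k} (hA : IsUnit A) :
    tensorMul k n r (fun _ => A) ∈ (Phi k n r).range := by
  obtain ⟨g, rfl⟩ := hA
  exact ⟨MonoidAlgebra.single g 1, by simp [Phi, MonoidAlgebra.lift_single]; rfl⟩

/-- The endomorphism `A ⊗ ⋯ ⊗ A` is a combination of the actions of invertible matrices, even for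
singular `A` and over a finite field. -/
theorem tensorMul_diag_mem (h : ringChar k = 0 ∨ r < ringChar k) (A : Matrix (Fin n) (Fin n) k) :
    tensorMul k n r (fun _ => A) ∈ (Phi k n r).range := by
  refine Matrix.diagonal_transvection_induction
    (fun A => tensorMul k n r (fun _ => A) ∈ (Phi k n r).range) A ?_ ?_ ?_
  · intro d _
    by_cases hd : ∀ i, d i ≠ 0
    · refine tensorMul_diag_mem_of_isUnit ?_
      rw [Matrix.isUnit_iff_isUnit_det, Matrix.det_diagonal, isUnit_iff_ne_zero]
      exact Finset.prod_ne_zero_iff.mpr fun i _ => hd i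
    · push Not at hd
      obtain ⟨i₀, hi₀⟩ := hd
      -- `diagonal d` is a nilpotent matrix times a permutation matrix.
      obtain ⟨m, rfl⟩ : ∃ m, n = m + 1 := Nat.exists_eq_succ_of_ne_zero (Fin.pos i₀).ne'
      have hN := isNilpotent_diagonal_mul_permMatrix d hi₀
      set P := (Equiv.addRight (1 : Fin (m + 1))).permMatrix k
      have hP : IsUnit P.det := by
        rw [Matrix.det_permutation]
        exact ((Equiv.Perm.sign _).isUnit.map (Int.castRingHom k))
      have hNmem : tensorMul k (m + 1) r (fun _ => Matrix.diagonal d * P) ∈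
          (Phi k (m + 1) r).range := by
        have hinterp := diag_mem_of_forall_add_smul_mem (ι := Fin r)
          (M := Module.End k (TensorSpace k (m + 1) r)) (by simpa using natCast_injOn_Iic h)
          (tensorMul k (m + 1) r) (Subalgebra.toSubmodule (Phi k (m + 1) r).range)
          (a := Matrix.diagonal d * P) (b := 1)
        refine hinterp (tensorMul_diag_mem_of_isUnit isUnit_one) fun t ht =>
          tensorMul_diag_mem_of_isUnit ?_
        have hu : IsUnit (t • (1 : Matrix (Fin (m + 1)) (Fin (m + 1)) k)) :=
          (isUnit_one).smul (Units.mk0 t ht)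
        exact hN.isUnit_add_right_of_commute hu ((Commute.one_right _).smul_right t)
      have : Matrix.diagonal d = Matrix.diagonal d * P * P⁻¹ :=
        (Matrix.mul_nonsing_inv_cancel_right _ _ hP).symm
      rw [this, tensorMul_mul]
      exact mul_mem hNmem (tensorMul_diag_mem_of_isUnit
        ((Matrix.isUnit_iff_isUnit_det _).mpr (Matrix.isUnit_nonsing_inv_det _ hP)))
  · intro t
    refine tensorMul_diag_mem_of_isUnit ?_
    rw [Matrix.isUnit_iff_isUnit_det, t.det]
    exact isUnit_one
  · intro A B hA hB
    rw [tensorMul_mul]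
    exact mul_mem hA hB

theorem span_range_tensorMul : Submodule.span k (Set.range (tensorMul k n r)) = ⊤ := by
  refine eq_top_iff.mpr fun F _ => ?_
  -- A rank one map `x ↦ b_J^*(x) • (w₁ ⊗ ⋯ ⊗ wᵣ)` is a tensor product of rank one maps.
  let b := Basis.piTensorProduct (fun _ : Fin r => Pi.basisFun k (Fin n))
  have hF : F = ∑ J, (b.coord J).smulRight (F (b J)) := by
    refine b.ext fun J => ?_
    simp [LinearMap.sum_apply, Finsupp.single_apply]
  rw [hF]
  refine Submodule.sum_mem _ fun J _ => ?_
  generalize F (b J) = x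
  induction x using PiTensorProduct.induction_on with
  | smul_tprod c w =>
    have : (b.coord J).smulRight (PiTensorProduct.tprod k w) =
        tensorMul k n r fun i => Matrix.vecMulVec (w i) (Pi.single (J i) 1) := by
      refine PiTensorProduct.ext (MultilinearMap.ext fun v => ?_)
      have hJ : b.coord J (PiTensorProduct.tprod k v) = ∏ i, v i (J i) := by
        simp [b, Basis.piTensorProduct_repr_tprod_apply]
      have hv (i : Fin r) : (Matrix.vecMulVec (w i) (Pi.single (J i) 1)).mulVec (v i) =
          v i (J i) • w i := by
        simp [Matrix.vecMulVec_mulVec]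
      simp only [LinearMap.compMultilinearMap_apply, LinearMap.smulRight_apply, hJ,
        tensorMul_tprod, hv, MultilinearMap.map_smul_univ]
    have h2 : (b.coord J).smulRight (c • PiTensorProduct.tprod k w) =
        c • (b.coord J).smulRight (PiTensorProduct.tprod k w) := by
      exact LinearMap.ext fun z => smul_comm _ _ _
    rw [h2, this]
    exact Submodule.smul_mem _ _ (Submodule.subset_span ⟨_, rfl⟩)
  | add x y hx hy =>
    have : (b.coord J).smulRight (x + y) = (b.coord J).smulRight x + (b.coord J).smulRight y := by
      ext; simp
    rw [this]
    exact Submodule.add_mem _ hx hy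

theorem Psi_single_mul_tensorMul_mul (σ : Equiv.Perm (Fin r))
    (A : Fin r → Matrix (Fin n) (Fin n) k) :
    Psi k n r (MulOpposite.op (MonoidAlgebra.single σ 1)) * tensorMul k n r A *
      Psi k n r (MulOpposite.op (MonoidAlgebra.single σ⁻¹ 1)) =
        tensorMul k n r fun i => A (σ i) := by
  refine PiTensorProduct.ext (MultilinearMap.ext fun v => ?_)
  simp only [LinearMap.compMultilinearMap_apply, Module.End.mul_apply]
  rw [Psi_single_tprod, tensorMul_tprod, Psi_single_tprod, tensorMul_tprod]
  simp

theorem Phi_commute_Psi (a : MonoidAlgebra k (GL (Fin n) k))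
    (b : (MonoidAlgebra k (Equiv.Perm (Fin r)))ᵐᵒᵖ) :
    Commute (Phi k n r a) (Psi k n r b) := by
  induction b using MulOpposite.rec' with | _ b =>
  induction a using MonoidAlgebra.induction_linear with
  | zero => simp
  | add x y hx hy => rw [map_add]; exact hx.add_left hy
  | single g c =>
    induction b using MonoidAlgebra.induction_linear with
    | zero => simp
    | add x y hx hy => rw [MulOpposite.op_add, map_add]; exact hx.add_right hy
    | single σ d =>
      have h1 : Phi k n r (MonoidAlgebra.single g c) = c • glAct k n r g := by
        simp [Phi, MonoidAlgebra.lift_single]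
      have h2 : MonoidAlgebra.single σ d = d • MonoidAlgebra.single σ (1 : k) := by simp
      rw [h1, h2, MulOpposite.op_smul, map_smul]
      refine Commute.smul_left (Commute.smul_right ?_ d) c
      refine PiTensorProduct.ext (MultilinearMap.ext fun v => ?_)
      simp only [LinearMap.compMultilinearMap_apply, Module.End.mul_apply]
      rw [Psi_single_tprod, glAct_tprod, glAct_tprod, Psi_single_tprod]

/-- Classical Schur-Weyl duality, first half: `Φ(k GL_n(k)) = End_{Σ_r}(T^{n,r})`. -/
theorem range_Phi_eq_centralizer (h : ringChar k = 0 ∨ r < ringChar k) :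
    (Phi k n r).range = Subalgebra.centralizer k ((Psi k n r).range : Set _) := by
  refine le_antisymm ?_ fun F hF => ?_
  · rintro _ ⟨a, rfl⟩
    rw [Subalgebra.mem_centralizer_iff]
    rintro _ ⟨b, rfl⟩
    exact (Phi_commute_Psi a b).symm
  -- `F` equals its average over `Σ_r`, and the averages of all endomorphisms come from `k GL_n(k)`.
  let s (σ : Equiv.Perm (Fin r)) := Psi k n r (MulOpposite.op (MonoidAlgebra.single σ 1))
  have hs (σ : Equiv.Perm (Fin r)) : s σ * s σ⁻¹ = 1 := by
    rw [← map_mul, ← MulOpposite.op_mul, MonoidAlgebra.single_mul_single]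
    simp [← MonoidAlgebra.one_def]
  have havg (G : Module.End k (TensorSpace k n r)) : ∑ σ, s σ * G * s σ⁻¹ ∈ (Phi k n r).range := by
    have hG : G ∈ Submodule.span k (Set.range (tensorMul k n r)) := by
      rw [span_range_tensorMul]; trivial
    induction hG using Submodule.span_induction with
    | mem G hG =>
      obtain ⟨A, rfl⟩ := hG
      simp only [s, Psi_single_mul_tensorMul_mul]
      have hpolar := sum_perm_mem_of_forall_diag_mem
        (M := Module.End k (TensorSpace k n r)) (tensorMul k n r) (Subalgebra.toSubmodule (Phi k n r).range)
      exact hpolar (tensorMul_diag_mem h) A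
    | zero => simp
    | add x y _ _ hx hy =>
      simp only [mul_add, add_mul, Finset.sum_add_distrib]
      exact add_mem hx hy
    | smul c x _ hx =>
      simp only [mul_smul_comm, smul_mul_assoc, ← Finset.smul_sum]
      exact Subalgebra.smul_mem _ hx c
  have hsum : ∑ σ, s σ * F * s σ⁻¹ = (r.factorial : k) • F := by
    have (σ : Equiv.Perm (Fin r)) : s σ * F * s σ⁻¹ = F := by
      rw [(Subalgebra.mem_centralizer_iff k).mp hF (s σ) ⟨_, rfl⟩, mul_assoc, hs, mul_one]
    simp [this, Fintype.card_perm, Nat.cast_smul_eq_nsmul]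
  have := Subalgebra.smul_mem _ (hsum ▸ havg F) (r.factorial : k)⁻¹
  rwa [inv_smul_smul₀ (factorial_cast_ne_zero h)] at this

theorem isSemisimpleRing_op_perm (h : ringChar k = 0 ∨ r < ringChar k) :
    IsSemisimpleRing (MonoidAlgebra k (Equiv.Perm (Fin r)))ᵐᵒᵖ := by
  have : NeZero (Nat.card (Equiv.Perm (Fin r)) : k) :=
    ⟨by simpa [Fintype.card_perm] using factorial_cast_ne_zero h⟩
  have : IsSemisimpleRing (MonoidAlgebra k (Equiv.Perm (Fin r))) :=
    inferInstanceAs (IsSemisimpleModule _ _)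
  infer_instance

/-- Classical Schur-Weyl duality, second half: `Ψ(k Σ_r) = End_{GL_n(k)}(T^{n,r})`. -/
theorem range_Psi_eq_centralizer (h : ringChar k = 0 ∨ r < ringChar k) :
    (Psi k n r).range = Subalgebra.centralizer k ((Phi k n r).range : Set _) := by
  have := isSemisimpleRing_op_perm h
  refine le_antisymm ?_ fun F hF => ?_
  · rintro _ ⟨b, rfl⟩
    rw [Subalgebra.mem_centralizer_iff]
    rintro _ ⟨a, rfl⟩
    exact Phi_commute_Psi a b
  · rw [range_Phi_eq_centralizer h] at hF
    exact mem_range_of_mem_centralizer_centralizer _ hF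

end Classical

/-! ### Restriction to Lie polynomials -/

theorem satisfiesSchurWeylDuality_lieSpace {k : Type*} [Field k] {n r : ℕ}
    (hchar : ringChar k = 0 ∨ r < ringChar k) {e : MonoidAlgebra k (Equiv.Perm (Fin r))}
    (he : IsLieIdempotent k n r e) :
    SatisfiesSchurWeylDuality (k := k) (V := LieSpace k n r) (PhiLie k n r) (PsiLie he) := by
  have := isSemisimpleRing_op_perm (k := k) (r := r) hchar
  have hcomm (a : MonoidAlgebra k (GL (Fin n) k)) (b : (he.idem.Corner)ᵐᵒᵖ) :
      Commute (PhiLie k n r a) (PsiLie he b) :=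
    LinearMap.ext fun t => Subtype.ext
      (LinearMap.congr_fun (Phi_commute_Psi a (MulOpposite.op b.unop.1)) t)
  let E := Psi k n r (MulOpposite.op e)
  have hE (t : TensorSpace k n r) : E t ∈ LieSpace k n r := he.range_eq.ge ⟨t, rfl⟩
  have hEE : E * E = E := by
    rw [← map_mul, ← MulOpposite.op_mul, he.idem.eq]
  have hEt (t : LieSpace k n r) : E t = t := he.Psi_eq_self t.2
  -- `ext f` is `f` precomposed with the projection `E` of tensor space onto `L^{n,r}`.
  let ext (f : Module.End k (LieSpace k n r)) : Module.End k (TensorSpace k n r) :=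
    (LieSpace k n r).subtype ∘ₗ f ∘ₗ E.codRestrict _ hE
  have ext_apply (f : Module.End k (LieSpace k n r)) (t : LieSpace k n r) :
      ext f t = f t := by
    have : E.codRestrict _ hE t = t := Subtype.ext (hEt t)
    simp [ext, this]
  have ext_mul (f : Module.End k (LieSpace k n r)) : ext f * E = ext f := by
    refine LinearMap.ext fun t => ?_
    have : E.codRestrict _ hE (E t) = E.codRestrict _ hE t :=
      Subtype.ext (LinearMap.congr_fun hEE t)
    simp [ext, this]
  constructor
  · refine le_antisymm ?_ fun f hf => ?_
    · rintro _ ⟨a, rfl⟩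
      rw [Subalgebra.mem_centralizer_iff]
      rintro _ ⟨b, rfl⟩
      exact (hcomm a b).symm
    · obtain ⟨F, hF, hFE⟩ := exists_mem_centralizer_mul_eq (Psi k n r)
        (congrArg MulOpposite.op he.idem.eq) (ext f) (ext_mul f) fun x => by
          let c : he.idem.Corner := ⟨e * x.unop * e, Subsemigroup.mem_corner_iff he.idem |>.mpr
            ⟨by simp only [← mul_assoc, he.idem.eq], by simp only [mul_assoc, he.idem.eq]⟩⟩
          have hc := (Subalgebra.mem_centralizer_iff k).mp hf _ ⟨MulOpposite.op c, rfl⟩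
          have hx : MulOpposite.op e * x * MulOpposite.op e = MulOpposite.op c.1 := by
            simp [c, mul_assoc, MulOpposite.op_mul]
          rw [hx]
          refine LinearMap.ext fun t => ?_
          have hcE : Psi k n r (MulOpposite.op c.1) * E = Psi k n r (MulOpposite.op c.1) := by
            rw [← map_mul, ← MulOpposite.op_mul, corner_mul_left]
          have h1 := congrArg Subtype.val (LinearMap.congr_fun hc (E.codRestrict _ hE t))
          have h2 := ext_apply f ⟨_, he.Psi_mem c t⟩
          have h3 := LinearMap.congr_fun hcE t
          refine h2.trans (Eq.trans ?_ h1.symm)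
          refine congrArg (fun y => (f y : TensorSpace k n r)) (Subtype.ext h3.symm)
      rw [← range_Phi_eq_centralizer hchar] at hF
      obtain ⟨a, rfl⟩ := hF
      refine ⟨a, LinearMap.ext fun t => Subtype.ext ?_⟩
      have := LinearMap.congr_fun hFE t
      rw [ext_apply, Module.End.mul_apply] at this
      rw [← this]
      exact congrArg (Phi k n r a) (hEt t).symm
  · refine le_antisymm ?_ fun f hf => ?_
    · rintro _ ⟨b, rfl⟩
      rw [Subalgebra.mem_centralizer_iff]
      rintro _ ⟨a, rfl⟩
      exact hcomm a b
    · have hmem : ext f ∈ (Psi k n r).range := by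
        rw [range_Psi_eq_centralizer hchar, Subalgebra.mem_centralizer_iff]
        rintro _ ⟨a, rfl⟩
        have ha := (Subalgebra.mem_centralizer_iff k).mp hf _ ⟨a, rfl⟩
        refine LinearMap.ext fun t => ?_
        have h1 := congrArg Subtype.val (LinearMap.congr_fun ha (E.codRestrict _ hE t))
        refine Eq.trans h1 ?_
        refine congrArg (fun y => (f y : TensorSpace k n r)) (Subtype.ext ?_)
        exact LinearMap.congr_fun (Phi_commute_Psi a (MulOpposite.op e)) t
      obtain ⟨b, hb⟩ := hmem
      refine ⟨MulOpposite.op ⟨e * b.unop * e, Subsemigroup.mem_corner_iff he.idem |>.mpr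
            ⟨by simp only [← mul_assoc, he.idem.eq], by simp only [mul_assoc, he.idem.eq]⟩⟩,
        LinearMap.ext fun t => Subtype.ext ?_⟩
      change Psi k n r (MulOpposite.op (e * b.unop * e)) t = f t
      have : MulOpposite.op (e * b.unop * e) = MulOpposite.op e * b * MulOpposite.op e := by
        simp [mul_assoc, MulOpposite.op_mul]
      rw [this, map_mul, map_mul, Module.End.mul_apply, Module.End.mul_apply]
      change E (Psi k n r b (E t)) = f t
      rw [hEt, show Psi k n r b = ext f from hb, ext_apply, hEt]

end LieSchurWeyl

theorem mainTheorem2 {k : Type*} [Field k] (n r : ℕ) (hchar : ringChar k = 0 ∨ r < ringChar k)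
    (e : MonoidAlgebra k (Equiv.Perm (Fin r))) (he : LieSchurWeyl.IsLieIdempotent k n r e) :
    LieSchurWeyl.SatisfiesSchurWeylDuality (k := k) (V := LieSchurWeyl.LieSpace k n r)
      (LieSchurWeyl.PhiLie k n r) (LieSchurWeyl.PsiLie he) :=
  LieSchurWeyl.satisfiesSchurWeylDuality_lieSpace hchar he
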